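/- Fix constants $\gamma>1$, $\hat a_R\ge 0$, $C_v>0$ and consider the one-dimensional radiation hydrodynamical equations in the zero diffusion limit $$\partial_t U+\partial_x F(U)=0,\qquad U=(\rho,m,E)^T,\quad F(U)=(\rho u,\ \rho u^2+p_{tot},\ u(E+p_{tot}))^T,$$ where $m=\rho u$, $T=e/C_v$, $p=(\gamma-1)\rho e$, $p_{tot}=p+\tfrac13\hat a_RT^4$, $E=\tfrac12\rho u^2+\rho e+\hat a_RT^4$, with $\rho>0$ and $e>0$ (so that $e>0$ is determined by $U$). Let $$S=C_v\ln\frac{p}{\rho^\gamma}+\frac{4\hat a_Re^3}{3\rho C_v^3},\qquad c=\sqrt{\frac p\rho+\frac{\hat K^2}{\rho e\tilde K}},\quad \hat K=p+\frac{4\hat a_Re^4}{3C_v^4},\quad \tilde K=\rho+\frac{4\hat a_Re^3}{C_v^4},$$ $$\frac{\partial p_{tot}}{\partial S}(\rho,S)=\Big(\frac{\partial S(\rho,e)}{\partial e}\Big)^{-1}\frac{\partial p_{tot}(\rho,e)}{\partial e}.$$ Consider the generalized Riemann problem with data $U(x,0)=U_L+xU'_L$ for $x<0$ and $U(x,0)=U_R+xU'_R$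 for $x>0$ (near $x=0$) in the acoustic case $U_L=U_R$, $U'_L\ne U'_R$. Let $U(x,t)$ be, near the origin, a piecewise $C^1$ weak solution: finitely many $C^1$ curves $x=X_i(t)$ with $X_i(0)=0$, strictly ordered for $t>0$, divide $t\ge 0$ into sectors; on each of them $U$ is the restriction of a function that is $C^1$ in a neighbourhood of the origin, and $U$ satisfies the equations between the curves and the Rankine–Hugoniot relations $X_i'(t)[U]=[F(U)]$ across them (on a curve, $U$ is one of its two one-sided limits). Suppose that no wave of positive strength starts at the origin, i.e. $U(x,t)\to U_*$ as $(x,t)\to(0,0)$, $t>0$; thus $U_*=U_L=U_R$. Write $u'_L$, $p'_{tot,L}$, $S'_L$ for the derivatives at $x=0$ of $u$, $p_{tot}$, $S$ along $x\mapsto U_L+xU'_L$, and similarly with $R$; a subscript $*$ denotes values at $U_*$. If $u_*-c_*<0<u_*+c_*$, then $$\Big(\frac{\partial u}{\partial t}\Big)_*=-\frac12\Big[(u_*+c_*)\Big(u'_L+\frac{p'_{tot,L}}{\rho_*c_*}\Big)+(u_*-c_*)\Big(u'_R-\frac{p'_{tot,R}}{\rho_*c_*}\Big)\Big],$$ $$\Big(\frac{\partial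 p_{tot}}{\partial t}\Big)_*=-\frac{\rho_*c_*}2\Big[(u_*+c_*)\Big(u'_L+\frac{p'_{tot,L}}{\rho_*c_*}\Big)-(u_*-c_*)\Big(u'_R-\frac{p'_{tot,R}}{\rho_*c_*}\Big)\Big],$$ $$\Big(\frac{\partial\rho}{\partial t}\Big)_*=\begin{cases}\dfrac1{c_*^2}\Big[\Big(\dfrac{\partial p_{tot}}{\partial t}\Big)_*+u_*\dfrac{\partial p_{tot}}{\partial S}(\rho_*,S_*)\,S'_L\Big],&u_*>0,\\[2mm]\dfrac1{c_*^2}\Big[\Big(\dfrac{\partial p_{tot}}{\partial t}\Big)_*+u_*\dfrac{\partial p_{tot}}{\partial S}(\rho_*,S_*)\,S'_R\Big],&u_*<0.\end{cases}$$ Here, for $q=u,p_{tot},\rho$, the assertion $(\partial q/\partial t)_*=d$ means: $\partial_t q(0,t)$ exists for all small $t>0$ for which $(0,t)$ is on none of the curves, it tends to $d$ as $t\to0+$ through such $t$, and $(q(0,t)-q_*)/t\to d$ as $t\to 0+$. -/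

import Mathlib

open Set Filter Topology

noncomputable section

namespace RHE

/-! Thermodynamics of the radiating perfect gas. The parameters are the adiabatic index `γ`, the
radiation coefficient `a` and the specific heat `Cv`; the temperature is `T = e / Cv`. -/

/-- Gas pressure `p = (γ - 1) ρ e`. -/
def gasPressure (γ ρ e : ℝ) : ℝ := (γ - 1) * ρ * e

/-- Total pressure `p_tot = p + a T⁴ / 3` as a function of `(ρ, e)`. -/
def pTot (γ a Cv ρ e : ℝ) : ℝ := gasPressure γ ρ e + a * (e / Cv) ^ 4 / 3

/-- Entropy `S = Cv ln (p / ρ ^ γ) + 4 a e³ / (3 ρ Cv³)` as a function of `(ρ, e)`. -/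
def entropy (γ a Cv ρ e : ℝ) : ℝ :=
  Cv * Real.log (gasPressure γ ρ e / ρ ^ γ) + 4 * a * e ^ 3 / (3 * ρ * Cv ^ 3)

/-- `K̂ = p + 4 a e⁴ / (3 Cv⁴)`. -/
def Khat (γ a Cv ρ e : ℝ) : ℝ := gasPressure γ ρ e + 4 * a * e ^ 4 / (3 * Cv ^ 4)

/-- `K̃ = ρ + 4 a e³ / Cv⁴`. -/
def Ktilde (a Cv ρ e : ℝ) : ℝ := ρ + 4 * a * e ^ 3 / Cv ^ 4

/-- Speed of sound `c = √((∂p_tot/∂ρ)_S) = √(p / ρ + K̂² / (ρ e K̃))`. -/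
def sound (γ a Cv ρ e : ℝ) : ℝ :=
  Real.sqrt (gasPressure γ ρ e / ρ + Khat γ a Cv ρ e ^ 2 / (ρ * e * Ktilde a Cv ρ e))

/-- `∂p_tot(ρ, S)/∂S = (∂S(ρ, e)/∂e)⁻¹ ∂p_tot(ρ, e)/∂e`. -/
def dpTotdS (γ a Cv ρ e : ℝ) : ℝ :=
  (deriv (fun ε => entropy γ a Cv ρ ε) e)⁻¹ * deriv (fun ε => pTot γ a Cv ρ ε) e

/-! Conservative vectors `U = (ρ, m, E)` with `m = ρ u` and
`E = m² / (2 ρ) + ρ e + a T⁴`, and the quantities that they determine. -/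

/-- Physically admissible states: positive density and positive internal energy. -/
def Admissible (U : Fin 3 → ℝ) : Prop := 0 < U 0 ∧ U 1 ^ 2 / (2 * U 0) < U 2

/-- `e` is the specific internal energy of the state `U`. -/
def IsSpecificEnergy (a Cv : ℝ) (U : Fin 3 → ℝ) (e : ℝ) : Prop :=
  0 < e ∧ U 2 = U 1 ^ 2 / (2 * U 0) + U 0 * e + a * (e / Cv) ^ 4

open Classical in
/-- The specific internal energy of `U`: the positive root of the quartic energy relation
(it exists and is unique if `U` is admissible, `0 ≤ a` and `0 < Cv`). -/
def specificEnergy (a Cv : ℝ) (U : Fin 3 → ℝ) : ℝ :=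
  if h : ∃ e, IsSpecificEnergy a Cv U e then h.choose else 0

/-- Density of `U`. -/
def density (U : Fin 3 → ℝ) : ℝ := U 0

/-- Velocity of `U`. -/
def velocity (U : Fin 3 → ℝ) : ℝ := U 1 / U 0

/-- Total pressure of `U`. -/
def pressureOf (γ a Cv : ℝ) (U : Fin 3 → ℝ) : ℝ := pTot γ a Cv (U 0) (specificEnergy a Cv U)

/-- Entropy of `U`. -/
def entropyOf (γ a Cv : ℝ) (U : Fin 3 → ℝ) : ℝ := entropy γ a Cv (U 0) (specificEnergy a Cv U)

/-- Speed of sound of `U`. -/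
def soundOf (γ a Cv : ℝ) (U : Fin 3 → ℝ) : ℝ := sound γ a Cv (U 0) (specificEnergy a Cv U)

/-- `∂p_tot/∂S (ρ, S)` at the state `U`. -/
def dpdSOf (γ a Cv : ℝ) (U : Fin 3 → ℝ) : ℝ := dpTotdS γ a Cv (U 0) (specificEnergy a Cv U)

/-- The flux `F(U) = (ρ u, ρ u² + p_tot, u (E + p_tot))`. -/
def flux (γ a Cv : ℝ) (U : Fin 3 → ℝ) : Fin 3 → ℝ :=
  ![U 0 * velocity U,
    U 0 * velocity U ^ 2 + pressureOf γ a Cv U,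
    velocity U * (U 2 + pressureOf γ a Cv U)]

/-- The slope at the origin of a scalar quantity `q` of the state along the linear initial data
`x ↦ U₀ + x U₀'`. -/
def dataSlope (q : (Fin 3 → ℝ) → ℝ) (U₀ U₀' : Fin 3 → ℝ) : ℝ :=
  deriv (fun x : ℝ => q (U₀ + x • U₀')) 0

/-! The generalized Riemann problem. Points are `q = (x, t)`. -/

/-- `q = (x, t)` lies in the `k`-th of the `n + 1` open sectors cut out by the curves
`x = X 0 t, …, x = X (n - 1) t`, numbered from left to right. -/
def InSector {n : ℕ} (X : Fin n → ℝ → ℝ) (k : Fin (n + 1)) (q : ℝ × ℝ) : Prop :=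
  (∀ i : Fin n, i.castSucc < k → X i q.2 < q.1) ∧
  (∀ i : Fin n, k ≤ i.castSucc → q.1 < X i q.2)

/-- `U` is, near the origin, a piecewise `C¹` weak solution of `∂U/∂t + ∂F(U)/∂x = 0`, `t > 0`,
with the piecewise linear data `U_L + x U_L'` (`x < 0`), `U_R + x U_R'` (`x > 0`), which has the
limiting state `Us` at the origin (so that no wave of positive strength starts there).

The finitely many wave curves `X i` start at the origin; neither their speeds nor the continuity
of `U` across them is prescribed. `W k` is a `C¹` extension, to a neighbourhood of the origin, of
the restriction of `U` to the `k`-th sector. -/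
structure IsAcousticSolution (γ a Cv : ℝ) (UL UR UL' UR' Us : Fin 3 → ℝ)
    (U : ℝ × ℝ → Fin 3 → ℝ) {n : ℕ} (X : Fin n → ℝ → ℝ)
    (W : Fin (n + 1) → ℝ × ℝ → Fin 3 → ℝ) : Prop where
  curve_smooth : ∀ i, ContDiffAt ℝ 1 (X i) 0
  curve_origin : ∀ i, X i 0 = 0
  curve_order : ∀ᶠ t in 𝓝[>] (0 : ℝ), StrictMono fun i => X i t
  piece_smooth : ∀ k, ContDiffAt ℝ 1 (W k) (0, 0)
  piece_eq : ∀ k, ∀ᶠ q in 𝓝[{q : ℝ × ℝ | 0 ≤ q.2}] (0, 0), InSector X k q → U q = W k q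
  /-- On a wave curve `U` takes one of its two one-sided limits. -/
  curve_value : ∀ i : Fin n, ∀ᶠ t in 𝓝[>] (0 : ℝ),
    U (X i t, t) = W i.castSucc (X i t, t) ∨ U (X i t, t) = W i.succ (X i t, t)
  /-- The differential equation away from the wave curves. -/
  equation : ∀ᶠ q in 𝓝[{q : ℝ × ℝ | 0 < q.2}] (0, 0), (∀ i, q.1 ≠ X i q.2) →
    deriv (fun t => U (q.1, t)) q.2 + deriv (fun x => flux γ a Cv (U (x, q.2))) q.1 = 0
  /-- The Rankine–Hugoniot relations across the wave curves. -/
  rankine_hugoniot : ∀ i : Fin n, ∀ᶠ t in 𝓝[>] (0 : ℝ),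
    deriv (X i) t • (W i.succ (X i t, t) - W i.castSucc (X i t, t)) =
      flux γ a Cv (W i.succ (X i t, t)) - flux γ a Cv (W i.castSucc (X i t, t))
  initial_left : ∀ᶠ x in 𝓝[<] (0 : ℝ), U (x, 0) = UL + x • UL'
  initial_right : ∀ᶠ x in 𝓝[>] (0 : ℝ), U (x, 0) = UR + x • UR'
  limit_state : Tendsto U (𝓝[{q : ℝ × ℝ | 0 < q.2}] (0, 0)) (𝓝 Us)

/-- `d` is the limiting value at `x = 0`, `t → 0+` of the time derivative of the scalar quantity
`q` of the state: along the `t`-axis, the classical derivative of `q(U(0, t))` exists off the wave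
curves and tends to `d`, and `d` is also the right derivative at `t = 0` of `q(U(0, t))`, continued
by its limiting value `q(Us)`. -/
def HasLimitTimeDeriv (U : ℝ × ℝ → Fin 3 → ℝ) {n : ℕ} (X : Fin n → ℝ → ℝ) (Us : Fin 3 → ℝ)
    (q : (Fin 3 → ℝ) → ℝ) (d : ℝ) : Prop :=
  (∀ᶠ t in 𝓝[{t : ℝ | 0 < t ∧ ∀ i, X i t ≠ 0}] 0, DifferentiableAt ℝ (fun τ => q (U (0, τ))) t) ∧
  Tendsto (fun t => deriv (fun τ => q (U (0, τ))) t)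
    (𝓝[{t : ℝ | 0 < t ∧ ∀ i, X i t ≠ 0}] 0) (𝓝 d) ∧
  Tendsto (fun t => (q (U (0, t)) - q Us) / t) (𝓝[>] (0 : ℝ)) (𝓝 d)

end RHE

end

namespace RHE

/-! ### The specific internal energy as a smooth function of the conservative variables -/

/-! Everything reduces to linear algebra at the single state `Us`. Let `A` be the differential of
the flux there. Every sector is nonempty near the origin, so each extension `W k` takes the value
`Us` at the origin, and by continuity its derivatives satisfy `∂ₜW + A ∂ₓW = 0` there.

The jump across a curve of initial speed `σ` vanishes at the origin, so the Rankine–Hugoniot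
relation differentiates to `(σ - A)[∂ₜW + σ ∂ₓW] = 0`, i.e. `(σ - A)² [∂ₓW] = 0`. If `ℓ ∘ A = λ ℓ`,
then `(σ - λ)² [ℓ(∂ₓW)] = 0`: `ℓ(∂ₓW)` jumps only across curves of initial speed `λ`
(`left_eigenvector_slope_eq`). No classification of the waves is needed.

A sector that meets the time axis at arbitrarily small times has only curves of speed `≤ 0` on its
left and `≥ 0` on its right. Hence for `λ > 0` its value of `ℓ(∂ₓW)` is that of the left data, for
`λ < 0` that of the right data, and `ℓ(∂ₜW) = -λ ℓ(∂ₓW)`.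

The left eigenforms are `dp ± ρ c du` with eigenvalue `u ± c`, and `dS` with eigenvalue `u`. The
first two determine `∂ₜu` and `∂ₜp`; then `dp = c² dρ + (∂p/∂S) dS` gives `∂ₜρ`. -/

theorem exists_isSpecificEnergy {a Cv : ℝ} (ha : 0 ≤ a) {U : Fin 3 → ℝ} (hU : Admissible U) :
    ∃ e, IsSpecificEnergy a Cv U e := by
  obtain ⟨h0, h1⟩ := hU
  set g : ℝ → ℝ := fun e => U 1 ^ 2 / (2 * U 0) + U 0 * e + a * (e / Cv) ^ 4 with hg
  have hgc : Continuous g := by fun_prop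
  -- The root in the absence of radiation; the nonnegative radiation term makes it an upper endpoint
  -- for the intermediate value theorem.
  set e₁ : ℝ := (U 2 - U 1 ^ 2 / (2 * U 0)) / U 0 with he₁
  have he₁pos : 0 < e₁ := div_pos (sub_pos.2 h1) h0
  have hg0 : g 0 < U 2 := by simpa [hg] using h1
  have hg1 : U 2 ≤ g e₁ := by
    have : U 0 * e₁ = U 2 - U 1 ^ 2 / (2 * U 0) := by rw [he₁]; field_simp
    have h4 : 0 ≤ a * (e₁ / Cv) ^ 4 := mul_nonneg ha (by positivity)
    simp only [hg]
    linarith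
  obtain ⟨e, ⟨he0, -⟩, he⟩ := intermediate_value_Icc he₁pos.le hgc.continuousOn ⟨hg0.le, hg1⟩
  refine ⟨e, lt_of_le_of_ne he0 ?_, he.symm⟩
  rintro rfl
  exact hg0.ne he

theorem isSpecificEnergy_specificEnergy {a Cv : ℝ} (ha : 0 ≤ a) {U : Fin 3 → ℝ}
    (hU : Admissible U) : IsSpecificEnergy a Cv U (specificEnergy a Cv U) := by
  have h := exists_isSpecificEnergy (Cv := Cv) ha hU
  rw [specificEnergy, dif_pos h]
  exact h.choose_spec

theorem IsSpecificEnergy.unique {a Cv : ℝ} (ha : 0 ≤ a) (hCv : 0 < Cv) {U : Fin 3 → ℝ}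
    (hU : 0 < U 0) {e₁ e₂ : ℝ} (h₁ : IsSpecificEnergy a Cv U e₁)
    (h₂ : IsSpecificEnergy a Cv U e₂) : e₁ = e₂ := by
  have key : ∀ {x y : ℝ}, IsSpecificEnergy a Cv U x → IsSpecificEnergy a Cv U y → ¬ x < y := by
    intro x y hx hy hxy
    have h1 : U 0 * x < U 0 * y := mul_lt_mul_of_pos_left hxy hU
    have h2 : a * (x / Cv) ^ 4 ≤ a * (y / Cv) ^ 4 := by
      have := hx.1
      gcongr
    linarith [hx.2, hy.2]
  exact le_antisymm (not_lt.1 (key h₂ h₁)) (not_lt.1 (key h₁ h₂))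

theorem Ktilde_pos {a Cv ρ e : ℝ} (ha : 0 ≤ a) (hCv : 0 < Cv) (hρ : 0 < ρ) (he : 0 < e) :
    0 < Ktilde a Cv ρ e := by
  unfold Ktilde
  positivity

theorem Admissible.eventually {U : Fin 3 → ℝ} (hU : Admissible U) : ∀ᶠ V in 𝓝 U, Admissible V := by
  have h0 : Tendsto (fun V : Fin 3 → ℝ => V 0) (𝓝 U) (𝓝 (U 0)) := (continuous_apply 0).tendsto U
  have h1 : Tendsto (fun V : Fin 3 → ℝ => V 1) (𝓝 U) (𝓝 (U 1)) := (continuous_apply 1).tendsto U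
  have h2 : Tendsto (fun V : Fin 3 → ℝ => V 2) (𝓝 U) (𝓝 (U 2)) := (continuous_apply 2).tendsto U
  have hk := (h1.pow 2).div (h0.const_mul 2) (by have := hU.1; positivity)
  filter_upwards [h0.eventually_const_lt hU.1, hk.eventually_lt h2 hU.2] with V hV hV'
  exact ⟨hV, hV'⟩

/-- The energy relation has `e`-derivative `Ktilde > 0`, so the implicit function theorem gives a
`C¹` root near `U`. It stays positive, and uniqueness of the positive root identifies it with the
chosen `specificEnergy`. -/
theorem contDiffAt_specificEnergy {a Cv : ℝ} (ha : 0 ≤ a) (hCv : 0 < Cv) {U : Fin 3 → ℝ}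
    (hU : Admissible U) : ContDiffAt ℝ 1 (specificEnergy a Cv) U := by
  obtain ⟨he, hrel⟩ := isSpecificEnergy_specificEnergy (Cv := Cv) ha hU
  set e := specificEnergy a Cv U with hedef
  set f : (Fin 3 → ℝ) × ℝ → ℝ :=
    fun v => v.1 1 ^ 2 / (2 * v.1 0) + v.1 0 * v.2 + a * (v.2 / Cv) ^ 4 - v.1 2 with hf
  have h0 : (2 * U 0) ≠ 0 := by have := hU.1; positivity
  have hfc : ContDiffAt ℝ 1 f (U, e) := by
    have h : ∀ i, ContDiffAt ℝ 1 (fun v : (Fin 3 → ℝ) × ℝ => v.1 i) (U, e) := fun i => by fun_prop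
    exact (((((h 1).pow 2).div (contDiffAt_const.mul (h 0)) h0).add
      ((h 0).mul contDiffAt_snd)).add
        (contDiffAt_const.mul ((contDiffAt_snd.div_const Cv).pow 4))).sub (h 2)
  have hder : (fderiv ℝ f (U, e) ∘L .inr ℝ (Fin 3 → ℝ) ℝ) 1 = Ktilde a Cv (U 0) e := by
    have hline : HasDerivAt (fun s : ℝ => ((U, e + s) : (Fin 3 → ℝ) × ℝ)) ((0 : Fin 3 → ℝ), (1:ℝ)) 0 :=
      (hasDerivAt_const _ _).prodMk ((hasDerivAt_id (0:ℝ)).const_add e)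
    have hd := (hfc.differentiableAt one_ne_zero).hasFDerivAt.comp_hasDerivAt_of_eq (0:ℝ) hline
      (by simp)
    have hd' : HasDerivAt (f ∘ fun s : ℝ => ((U, e + s) : (Fin 3 → ℝ) × ℝ))
        (Ktilde a Cv (U 0) e) 0 := by
      have h1 : HasDerivAt (fun s : ℝ => e + s) 1 0 := (hasDerivAt_id (0:ℝ)).const_add e
      have := ((((hasDerivAt_const (0:ℝ) (U 1 ^ 2 / (2 * U 0))).add (h1.const_mul (U 0))).add
        (((h1.div_const Cv).pow 4).const_mul a))).sub_const (U 2)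
      refine this.congr_deriv ?_
      simp only [Ktilde, add_zero, Nat.cast_ofNat, Nat.add_one_sub_one]
      field_simp
      ring
    simpa using hd.unique hd'
  have hK := Ktilde_pos ha hCv hU.1 he
  have hinv : (fderiv ℝ f (U, e) ∘L .inr ℝ (Fin 3 → ℝ) ℝ).IsInvertible := by
    refine ⟨ContinuousLinearEquiv.unitsEquivAut ℝ (Units.mk0 _ hK.ne'), ?_⟩
    ext
    simpa using hder.symm
  have hψ := hfc.contDiffAt_implicitFunction one_ne_zero hinv
  have hψ0 := hfc.implicitFunction_apply_self one_ne_zero hinv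
  have hψe := hfc.eventually_apply_implicitFunction one_ne_zero hinv
  set ψ := hfc.implicitFunction one_ne_zero hinv
  refine hψ.congr_of_eventuallyEq ?_
  have hpos : ∀ᶠ V in 𝓝 U, 0 < ψ V :=
    hψ.continuousAt.eventually (lt_mem_nhds (by rw [hψ0]; exact he))
  filter_upwards [hpos, hψe, hU.eventually] with V hV hV' hVa
  refine (isSpecificEnergy_specificEnergy ha hVa).unique ha hCv hVa.1 ⟨hV, ?_⟩
  have : f (U, e) = 0 := by simp only [hf]; linarith
  rw [this] at hV'
  simp only [hf] at hV'
  linarith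

/-! ### Differentials of the physical quantities -/

theorem contDiffAt_velocity {U : Fin 3 → ℝ} (hU : Admissible U) : ContDiffAt ℝ 1 velocity U := by
  have h : ∀ i, ContDiffAt ℝ 1 (fun v : Fin 3 → ℝ => v i) U := fun i => by fun_prop
  exact (h 1).div (h 0) hU.1.ne'

theorem contDiffAt_density (U : Fin 3 → ℝ) : ContDiffAt ℝ 1 density U :=
  contDiff_apply ℝ ℝ (0 : Fin 3) |>.contDiffAt

theorem contDiffAt_pressureOf {γ a Cv : ℝ} (ha : 0 ≤ a) (hCv : 0 < Cv) {U : Fin 3 → ℝ}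
    (hU : Admissible U) : ContDiffAt ℝ 1 (pressureOf γ a Cv) U := by
  have h := contDiffAt_specificEnergy ha hCv hU
  have h0 : ContDiffAt ℝ 1 (fun v : Fin 3 → ℝ => v 0) U := by fun_prop
  exact ((contDiffAt_const.mul h0).mul h).add
    ((contDiffAt_const.mul ((h.div_const Cv).pow 4)).div_const 3)

theorem contDiffAt_entropyOf {γ a Cv : ℝ} (hγ : 1 < γ) (ha : 0 ≤ a) (hCv : 0 < Cv) {U : Fin 3 → ℝ}
    (hU : Admissible U) : ContDiffAt ℝ 1 (entropyOf γ a Cv) U := by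
  have h := contDiffAt_specificEnergy ha hCv hU
  have he := (isSpecificEnergy_specificEnergy (Cv := Cv) ha hU).1
  have h0 : ContDiffAt ℝ 1 (fun v : Fin 3 → ℝ => v 0) U := by fun_prop
  have hρ := hU.1
  have hγ' : 0 < γ - 1 := sub_pos.2 hγ
  refine (contDiffAt_const.mul (ContDiffAt.log (((contDiffAt_const.mul h0).mul h).div
    (h0.rpow_const_of_ne hρ.ne') (Real.rpow_pos_of_pos hρ _).ne') ?_)).add
    ((contDiffAt_const.mul (h.pow 3)).div
      ((contDiffAt_const.mul h0).mul contDiffAt_const) (by positivity))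
  exact (div_pos (mul_pos (mul_pos hγ' hρ) he) (Real.rpow_pos_of_pos hρ _)).ne'

theorem contDiffAt_flux {γ a Cv : ℝ} (ha : 0 ≤ a) (hCv : 0 < Cv) {U : Fin 3 → ℝ}
    (hU : Admissible U) : ContDiffAt ℝ 1 (flux γ a Cv) U := by
  have h : ∀ i, ContDiffAt ℝ 1 (fun v : Fin 3 → ℝ => v i) U := fun i => by fun_prop
  have hv := contDiffAt_velocity hU
  have hp := contDiffAt_pressureOf (γ := γ) ha hCv hU
  refine contDiffAt_pi.2 fun i => ?_
  fin_cases i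
  · exact (h 0).mul hv
  · exact ((h 0).mul (hv.pow 2)).add hp
  · exact hv.mul ((h 2).add hp)

theorem hasDerivAt_line (U w : Fin 3 → ℝ) : HasDerivAt (fun s : ℝ => U + s • w) w 0 := by
  simpa using ((hasDerivAt_id (0:ℝ)).smul_const w).const_add U

/-- Reduces each differential to a one-variable derivative, so that the formulas below follow from
uniqueness of derivatives. -/
theorem hasDerivAt_comp_line {F : Type*} [NormedAddCommGroup F] [NormedSpace ℝ F]
    {q : (Fin 3 → ℝ) → F} {U : Fin 3 → ℝ} (hq : ContDiffAt ℝ 1 q U) (w : Fin 3 → ℝ) :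
    HasDerivAt (fun s : ℝ => q (U + s • w)) (fderiv ℝ q U w) 0 :=
  (hq.differentiableAt one_ne_zero).hasFDerivAt.comp_hasDerivAt_of_eq (0:ℝ) (hasDerivAt_line U w)
    (by simp)

theorem dataSlope_eq_fderiv {q : (Fin 3 → ℝ) → ℝ} {U : Fin 3 → ℝ} (hq : ContDiffAt ℝ 1 q U)
    (w : Fin 3 → ℝ) : dataSlope q U w = fderiv ℝ q U w :=
  (hasDerivAt_comp_line hq w).deriv

theorem hasDerivAt_line_apply (U w : Fin 3 → ℝ) (i : Fin 3) :
    HasDerivAt (fun s : ℝ => (U + s • w) i) (w i) 0 :=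
  hasDerivAt_pi.1 (hasDerivAt_line U w) i

theorem fderiv_density (U w : Fin 3 → ℝ) : fderiv ℝ density U w = w 0 :=
  (hasDerivAt_comp_line (contDiffAt_density U) w).unique (hasDerivAt_line_apply U w 0)

theorem fderiv_velocity {U : Fin 3 → ℝ} (hU : Admissible U) (w : Fin 3 → ℝ) :
    U 0 * fderiv ℝ velocity U w = w 1 - velocity U * w 0 := by
  have h0 := hU.1.ne'
  have := ((hasDerivAt_line_apply U w 1).div (hasDerivAt_line_apply U w 0)
    (by simpa using h0))
  rw [(hasDerivAt_comp_line (contDiffAt_velocity hU) w).unique this]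
  simp only [velocity, zero_smul, add_zero]
  field_simp

/-- Implicit differentiation of the energy relation along a line. -/
theorem fderiv_specificEnergy {a Cv : ℝ} (ha : 0 ≤ a) (hCv : 0 < Cv) {U : Fin 3 → ℝ}
    (hU : Admissible U) (w : Fin 3 → ℝ) :
    Ktilde a Cv (U 0) (specificEnergy a Cv U) * fderiv ℝ (specificEnergy a Cv) U w =
      w 2 - velocity U * w 1 + (velocity U ^ 2 / 2 - specificEnergy a Cv U) * w 0 := by
  have h0 := hU.1.ne'
  have hd := hasDerivAt_comp_line (contDiffAt_specificEnergy ha hCv hU) w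
  have hi := hasDerivAt_line_apply U w
  have hr := ((((hi 1).pow 2).div ((hi 0).const_mul 2) (by simpa using h0)).add
    ((hi 0).mul hd)).add (((hd.div_const Cv).pow 4).const_mul a)
  have hrel : (fun s : ℝ => (U + s • w) 2) =ᶠ[𝓝 0] fun s : ℝ => (U + s • w) 1 ^ 2 /
      (2 * (U + s • w) 0) + (U + s • w) 0 * specificEnergy a Cv (U + s • w) +
        a * (specificEnergy a Cv (U + s • w) / Cv) ^ 4 := by
    have hc : Tendsto (fun s : ℝ => U + s • w) (𝓝 0) (𝓝 U) := by
      simpa using (hasDerivAt_line U w).continuousAt.tendsto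
    filter_upwards [hc.eventually hU.eventually] with s hs
    exact (isSpecificEnergy_specificEnergy ha hs).2
  rw [(hi 2).unique (hr.congr_of_eventuallyEq hrel)]
  simp only [Ktilde, velocity, zero_smul, add_zero, Nat.cast_ofNat, Nat.add_one_sub_one, Pi.pow_apply]
  field_simp
  ring

theorem hasDerivAt_pTot {γ a Cv : ℝ} {r e : ℝ → ℝ} {r' e' s : ℝ}
    (hr : HasDerivAt r r' s) (he : HasDerivAt e e' s) :
    HasDerivAt (fun s => pTot γ a Cv (r s) (e s))
      ((γ - 1) * e s * r' + ((γ - 1) * r s + 4 * a * e s ^ 3 / (3 * Cv ^ 4)) * e') s := by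
  have := ((hr.const_mul (γ - 1)).mul he).add ((((he.div_const Cv).pow 4).const_mul a).div_const 3)
  refine this.congr_deriv ?_
  simp only [Nat.cast_ofNat, Nat.add_one_sub_one]
  ring

theorem hasDerivAt_entropy {γ a Cv : ℝ} (hγ : 1 < γ) (hCv : 0 < Cv) {r e : ℝ → ℝ} {r' e' s : ℝ}
    (hr : HasDerivAt r r' s) (he : HasDerivAt e e' s) (hr0 : 0 < r s) (he0 : 0 < e s) :
    HasDerivAt (fun s => entropy γ a Cv (r s) (e s))
      (Cv / (r s ^ 2 * e s) *
        (r s * Ktilde a Cv (r s) (e s) * e' - Khat γ a Cv (r s) (e s) * r')) s := by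
  have hγ' : 0 < γ - 1 := sub_pos.2 hγ
  have hpow : 0 < r s ^ γ := Real.rpow_pos_of_pos hr0 γ
  have := ((((((hr.const_mul (γ - 1)).mul he).div (hr.rpow_const (p := γ) (Or.inl hr0.ne'))
    hpow.ne').log (div_pos (mul_pos (mul_pos hγ' hr0) he0) hpow).ne').const_mul Cv)).add
      (((he.pow 3).const_mul (4 * a)).div ((hr.const_mul 3).mul_const (Cv ^ 3)) (by positivity))
  refine this.congr_deriv ?_
  simp only [Pi.mul_apply, Pi.pow_apply, Pi.div_apply, Real.rpow_sub_one hr0.ne', Ktilde, Khat,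
    gasPressure, Nat.cast_ofNat, Nat.add_one_sub_one]
  field_simp
  ring

theorem fderiv_pressureOf {γ a Cv : ℝ} (ha : 0 ≤ a) (hCv : 0 < Cv) {U : Fin 3 → ℝ}
    (hU : Admissible U) (w : Fin 3 → ℝ) :
    fderiv ℝ (pressureOf γ a Cv) U w = (γ - 1) * specificEnergy a Cv U * w 0 +
      ((γ - 1) * U 0 + 4 * a * specificEnergy a Cv U ^ 3 / (3 * Cv ^ 4)) *
        fderiv ℝ (specificEnergy a Cv) U w := by
  have := hasDerivAt_pTot (γ := γ) (a := a) (Cv := Cv) (hasDerivAt_line_apply U w 0)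
    (hasDerivAt_comp_line (contDiffAt_specificEnergy ha hCv hU) w)
  rw [(hasDerivAt_comp_line (contDiffAt_pressureOf ha hCv hU) w).unique this]
  simp only [zero_smul, add_zero]

theorem fderiv_entropyOf {γ a Cv : ℝ} (hγ : 1 < γ) (ha : 0 ≤ a) (hCv : 0 < Cv) {U : Fin 3 → ℝ}
    (hU : Admissible U) (w : Fin 3 → ℝ) :
    fderiv ℝ (entropyOf γ a Cv) U w = Cv / (U 0 ^ 2 * specificEnergy a Cv U) *
      (U 0 * Ktilde a Cv (U 0) (specificEnergy a Cv U) * fderiv ℝ (specificEnergy a Cv) U w -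
        Khat γ a Cv (U 0) (specificEnergy a Cv U) * w 0) := by
  have he := (isSpecificEnergy_specificEnergy (Cv := Cv) ha hU).1
  have := hasDerivAt_entropy (γ := γ) (a := a) hγ hCv (hasDerivAt_line_apply U w 0)
    (hasDerivAt_comp_line (contDiffAt_specificEnergy ha hCv hU) w) (by simpa using hU.1)
    (by simpa using he)
  rw [(hasDerivAt_comp_line (contDiffAt_entropyOf hγ ha hCv hU) w).unique this]
  simp only [zero_smul, add_zero]

theorem dpTotdS_eq {γ a Cv : ℝ} (hγ : 1 < γ) (hCv : 0 < Cv) {ρ e : ℝ}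
    (hρ : 0 < ρ) (he : 0 < e) :
    dpTotdS γ a Cv ρ e = (Cv / (ρ * e) * Ktilde a Cv ρ e)⁻¹ *
      ((γ - 1) * ρ + 4 * a * e ^ 3 / (3 * Cv ^ 4)) := by
  have h1 := (hasDerivAt_entropy (a := a) hγ hCv (hasDerivAt_const e ρ) (hasDerivAt_id e) hρ he).deriv
  have h2 := (hasDerivAt_pTot (γ := γ) (a := a) (Cv := Cv) (hasDerivAt_const e ρ)
    (hasDerivAt_id e)).deriv
  simp only [id_eq] at h1 h2
  rw [dpTotdS, h1, h2]
  have h : Cv / (ρ ^ 2 * e) * (ρ * Ktilde a Cv ρ e * 1 - Khat γ a Cv ρ e * 0) =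
      Cv / (ρ * e) * Ktilde a Cv ρ e := by
    field_simp
    ring
  rw [h]
  ring

theorem fderiv_flux_apply_zero {γ a Cv : ℝ} (ha : 0 ≤ a) (hCv : 0 < Cv) {U : Fin 3 → ℝ}
    (hU : Admissible U) (w : Fin 3 → ℝ) :
    fderiv ℝ (flux γ a Cv) U w 0 = w 0 * velocity U + U 0 * fderiv ℝ velocity U w := by
  have h := hasDerivAt_pi.1 (hasDerivAt_comp_line (contDiffAt_flux (γ := γ) ha hCv hU) w) 0
  have hv := hasDerivAt_comp_line (contDiffAt_velocity hU) w
  rw [h.unique ((hasDerivAt_line_apply U w 0).mul hv)]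
  simp only [zero_smul, add_zero]

theorem fderiv_flux_apply_one {γ a Cv : ℝ} (ha : 0 ≤ a) (hCv : 0 < Cv) {U : Fin 3 → ℝ}
    (hU : Admissible U) (w : Fin 3 → ℝ) :
    fderiv ℝ (flux γ a Cv) U w 1 = w 0 * velocity U ^ 2 +
      U 0 * (2 * velocity U * fderiv ℝ velocity U w) + fderiv ℝ (pressureOf γ a Cv) U w := by
  have h := hasDerivAt_pi.1 (hasDerivAt_comp_line (contDiffAt_flux (γ := γ) ha hCv hU) w) 1
  have hv := hasDerivAt_comp_line (contDiffAt_velocity hU) w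
  have hp := hasDerivAt_comp_line (contDiffAt_pressureOf (γ := γ) ha hCv hU) w
  rw [h.unique (((hasDerivAt_line_apply U w 0).mul (hv.pow 2)).add hp)]
  simp

theorem fderiv_flux_apply_two {γ a Cv : ℝ} (ha : 0 ≤ a) (hCv : 0 < Cv) {U : Fin 3 → ℝ}
    (hU : Admissible U) (w : Fin 3 → ℝ) :
    fderiv ℝ (flux γ a Cv) U w 2 = fderiv ℝ velocity U w * (U 2 + pressureOf γ a Cv U) +
      velocity U * (w 2 + fderiv ℝ (pressureOf γ a Cv) U w) := by
  have h := hasDerivAt_pi.1 (hasDerivAt_comp_line (contDiffAt_flux (γ := γ) ha hCv hU) w) 2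
  have hv := hasDerivAt_comp_line (contDiffAt_velocity hU) w
  have hp := hasDerivAt_comp_line (contDiffAt_pressureOf (γ := γ) ha hCv hU) w
  rw [h.unique (hv.mul ((hasDerivAt_line_apply U w 2).add hp))]
  simp

/-! ### The linearized flux in primitive variables -/

/-- With `w = ∂ₓU` and `∂ₜU = -A w` this is the velocity equation `ρ (uₜ + u uₓ) + pₓ = 0`. -/
theorem fderiv_velocity_fderiv_flux {γ a Cv : ℝ} (ha : 0 ≤ a) (hCv : 0 < Cv) {U : Fin 3 → ℝ}
    (hU : Admissible U) (w : Fin 3 → ℝ) :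
    U 0 * fderiv ℝ velocity U (fderiv ℝ (flux γ a Cv) U w) =
      U 0 * velocity U * fderiv ℝ velocity U w + fderiv ℝ (pressureOf γ a Cv) U w := by
  rw [fderiv_velocity hU, fderiv_flux_apply_zero ha hCv hU, fderiv_flux_apply_one ha hCv hU]
  ring

/-- The internal energy equation `K̃ (eₜ + u eₓ) + K̂ uₓ = 0`; `K̂` arises as total pressure plus
radiation energy. -/
theorem fderiv_specificEnergy_fderiv_flux {γ a Cv : ℝ} (ha : 0 ≤ a) (hCv : 0 < Cv)
    {U : Fin 3 → ℝ} (hU : Admissible U) (w : Fin 3 → ℝ) :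
    Ktilde a Cv (U 0) (specificEnergy a Cv U) *
        fderiv ℝ (specificEnergy a Cv) U (fderiv ℝ (flux γ a Cv) U w) =
      Ktilde a Cv (U 0) (specificEnergy a Cv U) * velocity U * fderiv ℝ (specificEnergy a Cv) U w +
        Khat γ a Cv (U 0) (specificEnergy a Cv U) * fderiv ℝ velocity U w := by
  have h1 := fderiv_specificEnergy ha hCv hU w
  have h2 := fderiv_velocity hU w
  have hE : U 2 = U 0 * velocity U ^ 2 / 2 + U 0 * specificEnergy a Cv U +
      a * (specificEnergy a Cv U / Cv) ^ 4 := by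
    have h0 := hU.1.ne'
    rw [(isSpecificEnergy_specificEnergy (Cv := Cv) ha hU).2, velocity]
    field_simp
  have hp : pressureOf γ a Cv U + a * (specificEnergy a Cv U / Cv) ^ 4 =
      Khat γ a Cv (U 0) (specificEnergy a Cv U) := by
    simp only [pressureOf, pTot, Khat]
    field_simp
    ring
  rw [fderiv_specificEnergy ha hCv hU, fderiv_flux_apply_zero ha hCv hU,
    fderiv_flux_apply_one ha hCv hU, fderiv_flux_apply_two ha hCv hU, hE, ← hp]
  linear_combination (-velocity U) * h1 - velocity U ^ 2 * h2

theorem sound_sq {γ a Cv ρ e : ℝ} (hγ : 1 < γ) (ha : 0 ≤ a) (hCv : 0 < Cv) (hρ : 0 < ρ)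
    (he : 0 < e) : sound γ a Cv ρ e ^ 2 =
      (γ - 1) * e + Khat γ a Cv ρ e ^ 2 / (ρ * e * Ktilde a Cv ρ e) := by
  have hK := Ktilde_pos ha hCv hρ he
  have hγ' : 0 < γ - 1 := sub_pos.2 hγ
  have h : gasPressure γ ρ e / ρ = (γ - 1) * e := by
    rw [gasPressure]
    field_simp
  rw [sound, h, Real.sq_sqrt (by positivity)]

theorem soundOf_pos {γ a Cv : ℝ} (hγ : 1 < γ) (ha : 0 ≤ a) (hCv : 0 < Cv) {U : Fin 3 → ℝ}
    (hU : Admissible U) : 0 < soundOf γ a Cv U := by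
  have he := (isSpecificEnergy_specificEnergy (Cv := Cv) ha hU).1
  have hρ := hU.1
  have hK := Ktilde_pos ha hCv hU.1 he
  have hγ' : 0 < γ - 1 := sub_pos.2 hγ
  refine Real.sqrt_pos.2 (add_pos_of_pos_of_nonneg (div_pos ?_ hρ) (by positivity))
  exact mul_pos (mul_pos hγ' hρ) he

/-- The chain rule for the pressure as a function of `(ρ, S)`; it justifies the formula for `c` by
showing `c² = (∂p/∂ρ)_S`. -/
theorem fderiv_pressureOf_eq {γ a Cv : ℝ} (hγ : 1 < γ) (ha : 0 ≤ a) (hCv : 0 < Cv)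
    {U : Fin 3 → ℝ} (hU : Admissible U) (w : Fin 3 → ℝ) :
    fderiv ℝ (pressureOf γ a Cv) U w = soundOf γ a Cv U ^ 2 * fderiv ℝ density U w +
      dpdSOf γ a Cv U * fderiv ℝ (entropyOf γ a Cv) U w := by
  have he := (isSpecificEnergy_specificEnergy (Cv := Cv) ha hU).1
  have hρ := hU.1
  have hK := Ktilde_pos ha hCv hρ he
  rw [fderiv_pressureOf ha hCv hU, fderiv_entropyOf hγ ha hCv hU, fderiv_density, dpdSOf, soundOf,
    dpTotdS_eq hγ hCv hρ he, sound_sq hγ ha hCv hρ he]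
  -- `K̂ = e ∂p_tot/∂e`: the identity through which the two terms of `c²` match.
  have hKh : Khat γ a Cv (U 0) (specificEnergy a Cv U) = specificEnergy a Cv U *
      ((γ - 1) * U 0 + 4 * a * specificEnergy a Cv U ^ 3 / (3 * Cv ^ 4)) := by
    simp only [Khat, gasPressure]
    ring
  rw [hKh]
  generalize (γ - 1) * U 0 + 4 * a * specificEnergy a Cv U ^ 3 / (3 * Cv ^ 4) = P
  field_simp
  ring

/-- `dS` is proportional to `ρ K̃ de - K̂ dρ`, and the `du` contributions of the energy and
continuity equations cancel in it: entropy is transported with speed `u`. -/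
theorem fderiv_entropyOf_fderiv_flux {γ a Cv : ℝ} (hγ : 1 < γ) (ha : 0 ≤ a) (hCv : 0 < Cv)
    {U : Fin 3 → ℝ} (hU : Admissible U) (w : Fin 3 → ℝ) :
    fderiv ℝ (entropyOf γ a Cv) U (fderiv ℝ (flux γ a Cv) U w) =
      velocity U * fderiv ℝ (entropyOf γ a Cv) U w := by
  have he := (isSpecificEnergy_specificEnergy (Cv := Cv) ha hU).1
  rw [fderiv_entropyOf hγ ha hCv hU, fderiv_entropyOf hγ ha hCv hU,
    fderiv_flux_apply_zero ha hCv hU]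
  linear_combination (Cv / (U 0 ^ 2 * specificEnergy a Cv U) * U 0) *
    fderiv_specificEnergy_fderiv_flux (γ := γ) ha hCv hU w

theorem fderiv_pressureOf_fderiv_flux {γ a Cv : ℝ} (hγ : 1 < γ) (ha : 0 ≤ a) (hCv : 0 < Cv)
    {U : Fin 3 → ℝ} (hU : Admissible U) (w : Fin 3 → ℝ) :
    fderiv ℝ (pressureOf γ a Cv) U (fderiv ℝ (flux γ a Cv) U w) =
      velocity U * fderiv ℝ (pressureOf γ a Cv) U w +
        U 0 * soundOf γ a Cv U ^ 2 * fderiv ℝ velocity U w := by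
  rw [fderiv_pressureOf_eq hγ ha hCv hU, fderiv_pressureOf_eq hγ ha hCv hU,
    fderiv_entropyOf_fderiv_flux hγ ha hCv hU, fderiv_density, fderiv_density,
    fderiv_flux_apply_zero ha hCv hU]
  ring

end RHE

namespace RHE

/-! ### Local analysis of a piecewise smooth solution at the origin -/

section Local

variable {E : Type*} [NormedAddCommGroup E] [NormedSpace ℝ E]

theorem eq_zero_of_tendsto_of_eventually {α β F : Type*} [TopologicalSpace β] [TopologicalSpace F]
    [T1Space F] [Zero F] {l : Filter α} [l.NeBot] {G : β → F} {b : β} {p : α → β}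
    (hG : ContinuousAt G b) (hp : Tendsto p l (𝓝 b)) (h : ∀ᶠ x in l, G (p x) = 0) : G b = 0 := by
  have h1 := hG.tendsto.comp hp
  have : ∀ᶠ x in l, (G ∘ p) x ∈ ({0} : Set F) := h
  simpa using isClosed_singleton.mem_of_tendsto h1 this

/-- A `C¹` function that satisfies a conservation law near points accumulating at `b` satisfies
it at `b`. -/
theorem conservationLaw_of_tendsto {f : E → E} {U W : ℝ × ℝ → E} {b : ℝ × ℝ} {α : Type*}
    {l : Filter α} [l.NeBot] {p : α → ℝ × ℝ} (hW : ContDiffAt ℝ 1 W b)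
    (hf : ContDiffAt ℝ 1 f (W b)) (hp : Tendsto p l (𝓝 b)) (hUW : ∀ᶠ x in l, U =ᶠ[𝓝 (p x)] W)
    (heq : ∀ᶠ x in l, deriv (fun t => U ((p x).1, t)) (p x).2 +
      deriv (fun y => f (U (y, (p x).2))) (p x).1 = 0) :
    fderiv ℝ W b (0, 1) + fderiv ℝ f (W b) (fderiv ℝ W b (1, 0)) = 0 := by
  -- The residual is continuous at `b` and vanishes along `p`, where `U` and `W` have the same
  -- germs.
  refine eq_zero_of_tendsto_of_eventually
    (G := fun q => fderiv ℝ W q (0, 1) + fderiv ℝ f (W q) (fderiv ℝ W q (1, 0))) ?_ hp ?_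
  · have h1 : ContinuousAt (fderiv ℝ W) b := (hW.fderiv_right (m := 0) (by simp)).continuousAt
    have h2 : ContinuousAt (fun q => fderiv ℝ f (W q)) b :=
      ContinuousAt.comp (f := W) (hf.fderiv_right (m := 0) (by simp)).continuousAt hW.continuousAt
    exact (h1.clm_apply continuousAt_const).add (h2.clm_apply (h1.clm_apply continuousAt_const))
  · filter_upwards [hUW, heq, hp.eventually (hW.eventually (by simp)),
      hp.eventually (hW.continuousAt.eventually (hf.eventually (by simp)))] with x h1 h2 h3 h4
    have ht : HasDerivAt (fun t => W ((p x).1, t)) (fderiv ℝ W (p x) (0, 1)) (p x).2 :=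
      (h3.differentiableAt one_ne_zero).hasFDerivAt.comp_hasDerivAt_of_eq (p x).2
        ((hasDerivAt_const _ _).prodMk (hasDerivAt_id _)) rfl
    have hx : HasDerivAt (fun y => W (y, (p x).2)) (fderiv ℝ W (p x) (1, 0)) (p x).1 :=
      (h3.differentiableAt one_ne_zero).hasFDerivAt.comp_hasDerivAt_of_eq (p x).1
        ((hasDerivAt_id _).prodMk (hasDerivAt_const _ _)) rfl
    have hfx : HasDerivAt (fun y => f (W (y, (p x).2)))
        (fderiv ℝ f (W (p x)) (fderiv ℝ W (p x) (1, 0))) (p x).1 :=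
      (h4.differentiableAt one_ne_zero).hasFDerivAt.comp_hasDerivAt_of_eq (p x).1 hx rfl
    have e1 : (fun t => U ((p x).1, t)) =ᶠ[𝓝 (p x).2] fun t => W ((p x).1, t) :=
      (show Tendsto (fun t => ((p x).1, t)) (𝓝 (p x).2) (𝓝 (p x)) from
        (by fun_prop : Continuous fun t => ((p x).1, t)).tendsto _).eventually h1
    have e2 : (fun y => U (y, (p x).2)) =ᶠ[𝓝 (p x).1] fun y => W (y, (p x).2) :=
      (show Tendsto (fun y => (y, (p x).2)) (𝓝 (p x).1) (𝓝 (p x)) from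
        (by fun_prop : Continuous fun y => (y, (p x).2)).tendsto _).eventually h1
    have e3 : (fun y => f (U (y, (p x).2))) =ᶠ[𝓝 (p x).1] fun y => f (W (y, (p x).2)) :=
      e2.fun_comp f
    rwa [e1.deriv_eq, ht.deriv, e3.deriv_eq, hfx.deriv] at h2

theorem hasDerivAt_along_curve {W : ℝ × ℝ → E} {X : ℝ → ℝ} (hW : ContDiffAt ℝ 1 W (0, 0))
    (hX : ContDiffAt ℝ 1 X 0) (hX0 : X 0 = 0) :
    HasDerivAt (fun t => W (X t, t)) (fderiv ℝ W (0, 0) (deriv X 0, 1)) 0 :=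
  (hW.differentiableAt one_ne_zero).hasFDerivAt.comp_hasDerivAt_of_eq (0:ℝ)
    ((hX.differentiableAt one_ne_zero).hasDerivAt.prodMk (hasDerivAt_id _)) (by simp [hX0])

/-- The Rankine–Hugoniot relations, linearized at a point where the jump vanishes. -/
theorem linearized_rankineHugoniot {f : E → E} {V W : ℝ × ℝ → E} {X : ℝ → ℝ} {b : E}
    (hX : ContDiffAt ℝ 1 X 0) (hX0 : X 0 = 0) (hV : ContDiffAt ℝ 1 V (0, 0))
    (hW : ContDiffAt ℝ 1 W (0, 0)) (hVb : V (0, 0) = b) (hWb : W (0, 0) = b)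
    (hf : ContDiffAt ℝ 1 f b)
    (hRH : ∀ᶠ t in 𝓝[>] (0 : ℝ),
      deriv X t • (W (X t, t) - V (X t, t)) = f (W (X t, t)) - f (V (X t, t))) :
    deriv X 0 • (fderiv ℝ W (0, 0) (deriv X 0, 1) - fderiv ℝ V (0, 0) (deriv X 0, 1)) =
      fderiv ℝ f b (fderiv ℝ W (0, 0) (deriv X 0, 1) - fderiv ℝ V (0, 0) (deriv X 0, 1)) := by
  have dV := hasDerivAt_along_curve hV hX hX0
  have dW := hasDerivAt_along_curve hW hX hX0
  have hfd := (hf.differentiableAt one_ne_zero).hasFDerivAt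
  have dfV : HasDerivAt (fun t => f (V (X t, t)))
      (fderiv ℝ f b (fderiv ℝ V (0, 0) (deriv X 0, 1))) 0 :=
    hfd.comp_hasDerivAt_of_eq (0:ℝ) dV (by simp [hX0, hVb])
  have dfW : HasDerivAt (fun t => f (W (X t, t)))
      (fderiv ℝ f b (fderiv ℝ W (0, 0) (deriv X 0, 1))) 0 :=
    hfd.comp_hasDerivAt_of_eq (0:ℝ) dW (by simp [hX0, hWb])
  have t1 := (hasDerivAt_iff_tendsto_slope_zero.1 (dW.sub dV)).mono_left
    (nhdsWithin_mono (0:ℝ) (fun x hx => ne_of_gt hx : Ioi (0:ℝ) ⊆ {0}ᶜ))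
  have t2 := (hasDerivAt_iff_tendsto_slope_zero.1 (dfW.sub dfV)).mono_left
    (nhdsWithin_mono (0:ℝ) (fun x hx => ne_of_gt hx : Ioi (0:ℝ) ⊆ {0}ᶜ))
  have t3 : Tendsto (deriv X) (𝓝[>] 0) (𝓝 (deriv X 0)) :=
    (((hX.fderiv_right (m := 0) (by simp)).continuousAt.clm_apply
      continuousAt_const).tendsto.mono_left nhdsWithin_le_nhds)
  rw [map_sub]
  -- Both jumps vanish at `t = 0`; dividing the relation by `t` and letting `t → 0+` turns them into
  -- derivatives.
  refine tendsto_nhds_unique (t3.smul t1) (t2.congr' ?_)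
  filter_upwards [hRH] with t ht
  simp [hX0, hVb, hWb, smul_comm (deriv X t), ht]

/-- Along a left eigenvector `ℓ` of the linearized flux, the slopes on both sides of a curve agree
unless the curve is characteristic. -/
theorem left_eigenvector_slope_eq {A : E →L[ℝ] E} {ℓ : E →L[ℝ] ℝ} {lam σ : ℝ}
    (hℓ : ∀ w, ℓ (A w) = lam * ℓ w) {DV DW : ℝ × ℝ →L[ℝ] E}
    (hDV : DV (0, 1) + A (DV (1, 0)) = 0) (hDW : DW (0, 1) + A (DW (1, 0)) = 0)
    (hRH : σ • (DW (σ, 1) - DV (σ, 1)) = A (DW (σ, 1) - DV (σ, 1))) (hσ : σ ≠ lam) :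
    ℓ (DW (1, 0)) = ℓ (DV (1, 0)) := by
  -- The law turns `∂ₜ + σ ∂ₓ` into `(σ - A) ∂ₓ`, on which `ℓ` produces a factor `σ - lam`; the
  -- Rankine–Hugoniot relation supplies a second one.
  have hsplit : ∀ D : ℝ × ℝ →L[ℝ] E, D (0, 1) + A (D (1, 0)) = 0 →
      ℓ (D (σ, 1)) = (σ - lam) * ℓ (D (1, 0)) := by
    intro D hD
    have h1 : ((σ, 1) : ℝ × ℝ) = σ • (1, 0) + (0, 1) := by simp
    rw [h1, map_add, map_smul, eq_neg_of_add_eq_zero_left hD, map_add, map_smul, map_neg, hℓ,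
      smul_eq_mul]
    ring
  have h := congrArg ℓ hRH
  rw [map_smul, hℓ, map_sub, hsplit _ hDV, hsplit _ hDW, smul_eq_mul] at h
  have h2 : (σ - lam) * (σ - lam) * (ℓ (DW (1, 0)) - ℓ (DV (1, 0))) = 0 := by linear_combination h
  have h3 := sub_ne_zero.2 hσ
  simpa [h3, sub_eq_zero] using h2

end Local

/-! ### Chaining equalities from a sector to the outermost ones. -/

theorem eq_zero_apply_of_forall_succ {n : ℕ} {β : Type*} {g : Fin (n + 1) → β} {k : Fin (n + 1)}
    (h : ∀ i : Fin n, i.castSucc < k → g i.succ = g i.castSucc) : g k = g 0 := by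
  induction k using Fin.induction with
  | zero => rfl
  | succ j ih =>
    rw [h j Fin.castSucc_lt_succ]
    exact ih fun i hi => h i (hi.trans Fin.castSucc_lt_succ)

theorem eq_last_apply_of_forall_succ {n : ℕ} {β : Type*} {g : Fin (n + 1) → β} {k : Fin (n + 1)}
    (h : ∀ i : Fin n, k ≤ i.castSucc → g i.succ = g i.castSucc) : g k = g (Fin.last n) := by
  induction k using Fin.reverseInduction with
  | last => rfl
  | cast j ih =>
    rw [← h j le_rfl]
    exact ih fun i hi => h i (Fin.castSucc_lt_succ.le.trans hi)

end RHE

namespace RHE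

/-! ### The sectors of an acoustic solution -/

theorem InSector.eventually {n : ℕ} {X : Fin n → ℝ → ℝ} {k : Fin (n + 1)} {q : ℝ × ℝ}
    (h : InSector X k q) (hX : ∀ i, ContinuousAt (X i) q.2) : ∀ᶠ q' in 𝓝 q, InSector X k q' := by
  have hc : ∀ i, Tendsto (fun q' : ℝ × ℝ => X i q'.2) (𝓝 q) (𝓝 (X i q.2)) := fun i =>
    (hX i).tendsto.comp (continuous_snd.tendsto q)
  have hx : Tendsto (fun q' : ℝ × ℝ => q'.1) (𝓝 q) (𝓝 q.1) := continuous_fst.tendsto q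
  refine (eventually_all.2 fun i => ?_).and (eventually_all.2 fun i => ?_)
  · by_cases hi : i.castSucc < k
    · exact ((hc i).eventually_lt hx (h.1 i hi)).mono fun _ h _ => h
    · exact Eventually.of_forall fun _ h => absurd h hi
  · by_cases hi : k ≤ i.castSucc
    · exact (hx.eventually_lt (hc i) (h.2 i hi)).mono fun _ h _ => h
    · exact Eventually.of_forall fun _ h => absurd h hi

/-- The time axis touches the closure of the `k`-th sector at time `t`. -/
def AxisTouches {n : ℕ} (X : Fin n → ℝ → ℝ) (k : Fin (n + 1)) (t : ℝ) : Prop :=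
  (∀ i : Fin n, i.castSucc < k → X i t ≤ 0) ∧ (∀ i : Fin n, k ≤ i.castSucc → 0 ≤ X i t)

theorem InSector.axisTouches {n : ℕ} {X : Fin n → ℝ → ℝ} {k : Fin (n + 1)} {t : ℝ}
    (h : InSector X k (0, t)) : AxisTouches X k t :=
  ⟨fun i hi => (h.1 i hi).le, fun i hi => (h.2 i hi).le⟩

theorem exists_inSector {n : ℕ} {X : Fin n → ℝ → ℝ} {q : ℝ × ℝ}
    (hmono : StrictMono fun i => X i q.2) (hne : ∀ i, q.1 ≠ X i q.2) : ∃ k, InSector X k q := by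
  classical
  -- The sector is the largest index all of whose preceding curves lie to the left of `q`; a later
  -- curve on the left would contradict maximality.
  set s : Finset (Fin (n + 1)) :=
    Finset.univ.filter fun k => ∀ i : Fin n, i.castSucc < k → X i q.2 < q.1 with hs
  have hne0 : s.Nonempty := ⟨0, by simp [hs]⟩
  have hmem := s.max'_mem hne0
  refine ⟨s.max' hne0, ?_, fun i hi => ?_⟩
  · exact (Finset.mem_filter.1 hmem).2
  · by_contra hlt
    have hlt' : X i q.2 < q.1 := lt_of_le_of_ne (not_lt.1 hlt) (hne i).symm
    have hsucc : i.succ ∈ s := by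
      refine Finset.mem_filter.2 ⟨Finset.mem_univ _, fun j hj => ?_⟩
      exact (hmono.monotone (Fin.castSucc_lt_succ_iff.1 hj)).trans_lt hlt'
    exact absurd (s.le_max' _ hsucc) (not_le.2 (hi.trans_lt Fin.castSucc_lt_succ))

section Acoustic

variable {γ a Cv : ℝ} {UL UR UL' UR' Us : Fin 3 → ℝ} {U : ℝ × ℝ → Fin 3 → ℝ} {n : ℕ}
  {X : Fin n → ℝ → ℝ} {W : Fin (n + 1) → ℝ × ℝ → Fin 3 → ℝ}

theorem IsAcousticSolution.eventually_continuousAt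
    (hU : IsAcousticSolution γ a Cv UL UR UL' UR' Us U X W) :
    ∀ᶠ t in 𝓝 (0 : ℝ), ∀ i, ContinuousAt (X i) t :=
  eventually_all.2 fun i => ((hU.curve_smooth i).eventually (by simp)).mono
    fun _ h => h.continuousAt

theorem tendsto_nhdsWithin_upper {y : ℝ → ℝ} (hy : Tendsto y (𝓝[>] 0) (𝓝 0)) :
    Tendsto (fun t => (y t, t)) (𝓝[>] 0) (𝓝[{q : ℝ × ℝ | 0 < q.2}] (0, 0)) :=
  tendsto_nhdsWithin_iff.2 ⟨hy.prodMk_nhds (tendsto_id.mono_left nhdsWithin_le_nhds),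
    self_mem_nhdsWithin⟩

/-- Sectors are open for `t > 0`, so pointwise agreement upgrades to equality of germs, which allows
derivatives to be compared. -/
theorem IsAcousticSolution.piece_eventuallyEq
    (hU : IsAcousticSolution γ a Cv UL UR UL' UR' Us U X W) (k : Fin (n + 1)) :
    ∀ᶠ q in 𝓝[{q : ℝ × ℝ | 0 < q.2}] (0, 0), InSector X k q → U =ᶠ[𝓝 q] W k := by
  have hopen : IsOpen {q : ℝ × ℝ | 0 < q.2} := isOpen_lt continuous_const continuous_snd
  have h1 := eventually_eventually_nhdsWithin.2 ((hU.piece_eq k).filter_mono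
    (nhdsWithin_mono (0, 0) (ofPred_subset_ofPred.2 fun _ => le_of_lt :
      {q : ℝ × ℝ | 0 < q.2} ⊆ {q : ℝ × ℝ | 0 ≤ q.2})))
  have h2 : ∀ᶠ q : ℝ × ℝ in 𝓝[{q : ℝ × ℝ | 0 < q.2}] (0, 0), ∀ i, ContinuousAt (X i) q.2 :=
    ((continuous_snd.tendsto ((0, 0) : ℝ × ℝ)).mono_left nhdsWithin_le_nhds).eventually
      hU.eventually_continuousAt
  filter_upwards [h1, h2, self_mem_nhdsWithin] with q hq1 hq2 hq3 hq
  rw [hopen.nhdsWithin_eq hq3] at hq1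
  filter_upwards [hq1, hq.eventually hq2] with q' h h' using h h'

/-- Provides a path to the origin inside each sector, halfway between its bounding curves, along
which limits can be taken. -/
theorem IsAcousticSolution.exists_tendsto_inSector
    (hU : IsAcousticSolution γ a Cv UL UR UL' UR' Us U X W) (k : Fin (n + 1)) :
    ∃ y : ℝ → ℝ, Tendsto y (𝓝[>] 0) (𝓝 0) ∧ ∀ᶠ t in 𝓝[>] (0 : ℝ), InSector X k (y t, t) := by
  -- For `t > 0`, `-M` and `M` lie strictly outside all curves and still tend to `0`; they bound the
  -- two outermost sectors.
  set M : ℝ → ℝ := fun t => t + ∑ i, |X i t| with hM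
  have hX0 : ∀ i, Tendsto (X i) (𝓝[>] 0) (𝓝 0) := fun i => by
    simpa [hU.curve_origin i] using (hU.curve_smooth i).continuousAt.tendsto.mono_left
      (nhdsWithin_le_nhds (s := Ioi 0))
  have hM0 : Tendsto M (𝓝[>] 0) (𝓝 0) := by
    have h := tendsto_finsetSum Finset.univ fun i _ => (hX0 i).abs
    simpa [hM] using (tendsto_id.mono_left (nhdsWithin_le_nhds (s := Ioi (0:ℝ)))).add h
  have hMX : ∀ t, 0 < t → ∀ i, |X i t| < M t := fun t ht i => by
    have := Finset.single_le_sum (f := fun i => |X i t|) (fun j _ => abs_nonneg _)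
      (Finset.mem_univ i)
    simp only [hM]
    linarith
  set lo : ℝ → ℝ := fun t => (Fin.cons (-M t) (fun i => X i t) : Fin (n + 1) → ℝ) k with hlo
  set hi : ℝ → ℝ := fun t => (Fin.snoc (fun i => X i t) (M t) : Fin (n + 1) → ℝ) k with hhi
  have hlo0 : Tendsto lo (𝓝[>] 0) (𝓝 0) := by
    cases k using Fin.cases with
    | zero => simpa [hlo] using hM0.neg
    | succ j => simpa [hlo] using hX0 j
  have hhi0 : Tendsto hi (𝓝[>] 0) (𝓝 0) := by
    cases k using Fin.lastCases with
    | last => simpa [hhi] using hM0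
    | cast j => simpa [hhi] using hX0 j
  refine ⟨fun t => (lo t + hi t) / 2, by simpa using (hlo0.add hhi0).div_const 2, ?_⟩
  filter_upwards [hU.curve_order, self_mem_nhdsWithin] with t ht ht0
  have h1 : ∀ i : Fin n, i.castSucc < k → X i t ≤ lo t := by
    intro i hik
    cases k using Fin.cases with
    | zero => exact absurd hik (Fin.not_lt_zero _)
    | succ j => simpa [hlo] using ht.monotone (Fin.castSucc_lt_succ_iff.1 hik)
  have h2 : ∀ i : Fin n, k ≤ i.castSucc → hi t ≤ X i t := by
    intro i hik
    cases k using Fin.lastCases with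
    | last => exact absurd hik (not_le.2 (Fin.castSucc_lt_last i))
    | cast j => simpa [hhi] using ht.monotone (Fin.castSucc_le_castSucc_iff.1 hik)
  have h3 : lo t < hi t := by
    have hMpos : 0 < M t := add_pos_of_pos_of_nonneg ht0 (Finset.sum_nonneg fun _ _ => abs_nonneg _)
    cases k using Fin.cases with
    | zero =>
      rcases eq_or_ne (0 : Fin (n + 1)) (Fin.last n) with h | h
      · have : hi t = M t := by simp only [hhi, h, Fin.snoc_last]
        simp only [hlo, Fin.cons_zero, this]
        linarith
      · have : hi t = X ((0 : Fin (n + 1)).castPred h) t := by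
          simp only [hhi]
          conv_lhs => rw [← Fin.castSucc_castPred 0 h, Fin.snoc_castSucc]
        simp only [hlo, Fin.cons_zero, this]
        exact (abs_lt.1 (hMX t ht0 _)).1
    | succ j =>
      rcases eq_or_ne j.succ (Fin.last n) with h | h
      · have : hi t = M t := by simp only [hhi, h, Fin.snoc_last]
        simp only [hlo, Fin.cons_succ, this]
        exact (abs_lt.1 (hMX t ht0 _)).2
      · have : hi t = X (j.succ.castPred h) t := by
          simp only [hhi]
          conv_lhs => rw [← Fin.castSucc_castPred j.succ h, Fin.snoc_castSucc]
        simp only [hlo, Fin.cons_succ, this]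
        refine ht (Fin.castSucc_lt_castSucc_iff.1 ?_)
        rw [Fin.castSucc_castPred]
        exact Fin.castSucc_lt_succ
  refine ⟨fun i hik => ?_, fun i hik => ?_⟩
  · have := h1 i hik
    simp only
    linarith
  · have := h2 i hik
    simp only
    linarith

theorem IsAcousticSolution.piece_origin
    (hU : IsAcousticSolution γ a Cv UL UR UL' UR' Us U X W) (k : Fin (n + 1)) :
    W k (0, 0) = Us := by
  obtain ⟨y, hy, hys⟩ := hU.exists_tendsto_inSector k
  have hp := tendsto_nhdsWithin_upper hy
  refine tendsto_nhds_unique ((hU.piece_smooth k).continuousAt.tendsto.comp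
    (hp.mono_right nhdsWithin_le_nhds)) ((hU.limit_state.comp hp).congr' ?_)
  filter_upwards [hp.eventually (hU.piece_eventuallyEq k), hys] with t h1 h2
  exact (h1 h2).eq_of_nhds

theorem IsAcousticSolution.piece_law
    (hU : IsAcousticSolution γ a Cv UL UR UL' UR' Us U X W)
    (hf : ContDiffAt ℝ 1 (flux γ a Cv) Us) (k : Fin (n + 1)) :
    fderiv ℝ (W k) (0, 0) (0, 1) +
      fderiv ℝ (flux γ a Cv) Us (fderiv ℝ (W k) (0, 0) (1, 0)) = 0 := by
  obtain ⟨y, hy, hys⟩ := hU.exists_tendsto_inSector k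
  have hp := tendsto_nhdsWithin_upper hy
  have h0 := hU.piece_origin k
  rw [← h0] at hf ⊢
  refine conservationLaw_of_tendsto (U := U) (hU.piece_smooth k) hf
    (hp.mono_right nhdsWithin_le_nhds) ?_ ?_
  · filter_upwards [hp.eventually (hU.piece_eventuallyEq k), hys] with t h1 h2 using h1 h2
  · filter_upwards [hp.eventually hU.equation, hys] with t h1 h2
    refine h1 fun i => ?_
    rcases lt_or_ge i.castSucc k with h | h
    · exact (h2.1 i h).ne'
    · exact (h2.2 i h).ne

theorem IsAcousticSolution.left_eigenvector_slope_eq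
    (hU : IsAcousticSolution γ a Cv UL UR UL' UR' Us U X W)
    (hf : ContDiffAt ℝ 1 (flux γ a Cv) Us) {ℓ : (Fin 3 → ℝ) →L[ℝ] ℝ} {lam : ℝ}
    (hℓ : ∀ w, ℓ (fderiv ℝ (flux γ a Cv) Us w) = lam * ℓ w) {i : Fin n}
    (hi : deriv (X i) 0 ≠ lam) :
    ℓ (fderiv ℝ (W i.succ) (0, 0) (1, 0)) = ℓ (fderiv ℝ (W i.castSucc) (0, 0) (1, 0)) :=
  RHE.left_eigenvector_slope_eq hℓ (hU.piece_law hf _) (hU.piece_law hf _)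
    (linearized_rankineHugoniot (hU.curve_smooth i) (hU.curve_origin i) (hU.piece_smooth _)
      (hU.piece_smooth _) (hU.piece_origin _) (hU.piece_origin _) hf (hU.rankine_hugoniot i)) hi

theorem affine_of_eventually_eq {V : ℝ × ℝ → Fin 3 → ℝ} {b b' : Fin 3 → ℝ} {s : Set ℝ}
    (hs : UniqueDiffWithinAt ℝ s 0) [(𝓝[s] (0 : ℝ)).NeBot] (hV : ContDiffAt ℝ 1 V (0, 0))
    (h : ∀ᶠ x in 𝓝[s] (0 : ℝ), V (x, 0) = b + x • b') :
    V (0, 0) = b ∧ fderiv ℝ V (0, 0) (1, 0) = b' := by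
  have hd : HasDerivAt (fun x : ℝ => V (x, 0)) (fderiv ℝ V (0, 0) (1, 0)) 0 :=
    (hV.differentiableAt one_ne_zero).hasFDerivAt.comp_hasDerivAt_of_eq (0:ℝ)
      ((hasDerivAt_id _).prodMk (hasDerivAt_const _ _)) rfl
  have hl := hasDerivAt_line b b'
  have h0 : V (0, 0) = b := by
    refine tendsto_nhds_unique (hd.continuousAt.tendsto.mono_left (nhdsWithin_le_nhds (s := s))) ?_
    have := hl.continuousAt.tendsto.mono_left (nhdsWithin_le_nhds (s := s))
    simp only [zero_smul, add_zero] at this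
    exact this.congr' (h.mono fun _ hx => hx.symm)
  refine ⟨h0, hs.eq_deriv s hd.hasDerivWithinAt ?_⟩
  exact hl.hasDerivWithinAt.congr_of_eventuallyEq h (by simpa using h0)

/-- `piece_eq` includes the line `t = 0`, where all curves sit at `0`, so the negative half-axis
belongs to sector `0`. -/
theorem IsAcousticSolution.first_piece
    (hU : IsAcousticSolution γ a Cv UL UR UL' UR' Us U X W) :
    W 0 (0, 0) = UL ∧ fderiv ℝ (W 0) (0, 0) (1, 0) = UL' := by
  refine affine_of_eventually_eq (uniqueDiffWithinAt_Iio 0) (hU.piece_smooth 0) ?_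
  have hp : Tendsto (fun x : ℝ => (x, (0:ℝ))) (𝓝[<] 0) (𝓝[{q : ℝ × ℝ | 0 ≤ q.2}] (0, 0)) :=
    tendsto_nhdsWithin_iff.2 ⟨(tendsto_id.mono_left nhdsWithin_le_nhds).prodMk_nhds
      tendsto_const_nhds, Eventually.of_forall fun _ => le_refl (0:ℝ)⟩
  filter_upwards [hp.eventually (hU.piece_eq 0), hU.initial_left, self_mem_nhdsWithin]
    with x h1 h2 hx
  rw [← h2, h1 ⟨fun i hi => absurd hi (Fin.not_lt_zero _), fun i _ => ?_⟩]
  simpa [hU.curve_origin i] using hx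

theorem IsAcousticSolution.last_piece
    (hU : IsAcousticSolution γ a Cv UL UR UL' UR' Us U X W) :
    W (Fin.last n) (0, 0) = UR ∧ fderiv ℝ (W (Fin.last n)) (0, 0) (1, 0) = UR' := by
  refine affine_of_eventually_eq (uniqueDiffWithinAt_Ioi 0) (hU.piece_smooth _) ?_
  have hp : Tendsto (fun x : ℝ => (x, (0:ℝ))) (𝓝[>] 0) (𝓝[{q : ℝ × ℝ | 0 ≤ q.2}] (0, 0)) :=
    tendsto_nhdsWithin_iff.2 ⟨(tendsto_id.mono_left nhdsWithin_le_nhds).prodMk_nhds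
      tendsto_const_nhds, Eventually.of_forall fun _ => le_refl (0:ℝ)⟩
  filter_upwards [hp.eventually (hU.piece_eq _), hU.initial_right, self_mem_nhdsWithin]
    with x h1 h2 hx
  rw [← h2, h1 ⟨fun i _ => ?_, fun i hi => absurd hi (not_le.2 (Fin.castSucc_lt_last i))⟩]
  simpa [hU.curve_origin i] using hx

/-! ### Time derivatives along the axis -/

/-- The `k`-th sector is adjacent to the time axis as far as the initial speeds of its bounding
curves can tell. -/
def SpeedsStraddle {n : ℕ} (X : Fin n → ℝ → ℝ) (k : Fin (n + 1)) : Prop :=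
  (∀ i : Fin n, i.castSucc < k → deriv (X i) 0 ≤ 0) ∧
  (∀ i : Fin n, k ≤ i.castSucc → 0 ≤ deriv (X i) 0)

theorem IsAcousticSolution.speedsStraddle_of_frequently
    (hU : IsAcousticSolution γ a Cv UL UR UL' UR' Us U X W) {k : Fin (n + 1)}
    (h : ∃ᶠ t in 𝓝[>] (0 : ℝ), AxisTouches X k t) : SpeedsStraddle X k := by
  -- Signs of `X i t / t` at arbitrarily small times pass to the initial speed; eventual contact
  -- with the axis is not required.
  have hs : ∀ i, Tendsto (fun t => t⁻¹ * X i t) (𝓝[>] 0) (𝓝 (deriv (X i) 0)) := fun i => by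
    have := (hasDerivAt_iff_tendsto_slope_zero.1
      ((hU.curve_smooth i).differentiableAt one_ne_zero).hasDerivAt).mono_left
        (nhdsWithin_mono (0:ℝ) (fun x hx => ne_of_gt hx : Ioi (0:ℝ) ⊆ {0}ᶜ))
    simpa [hU.curve_origin i] using this
  have h' := h.and_eventually (self_mem_nhdsWithin : ∀ᶠ t in 𝓝[>] (0:ℝ), 0 < t)
  refine ⟨fun i hi => le_of_not_gt fun hlt => ?_, fun i hi => le_of_not_gt fun hlt => ?_⟩
  · obtain ⟨t, ⟨ht, ht0⟩, hpos⟩ := (h'.and_eventually ((hs i).eventually_const_lt hlt)).exists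
    exact hpos.not_ge (mul_nonpos_of_nonneg_of_nonpos (inv_nonneg.2 ht0.le) (ht.1 i hi))
  · obtain ⟨t, ⟨ht, ht0⟩, hneg⟩ := (h'.and_eventually ((hs i).eventually_lt_const hlt)).exists
    exact hneg.not_ge (mul_nonneg (inv_nonneg.2 ht0.le) (ht.2 i hi))

theorem IsAcousticSolution.eventually_exists_axis_eq
    (hU : IsAcousticSolution γ a Cv UL UR UL' UR' Us U X W) :
    ∀ᶠ t in 𝓝[>] (0 : ℝ), ∃ k, AxisTouches X k t ∧ U (0, t) = W k (0, t) ∧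
      ((∀ i, X i t ≠ 0) → (fun τ => U (0, τ)) =ᶠ[𝓝 t] fun τ => W k (0, τ)) := by
  have hp := tendsto_nhdsWithin_upper (y := fun _ => 0) tendsto_const_nhds
  filter_upwards [hU.curve_order, eventually_all.2 hU.curve_value,
    eventually_all.2 fun k => hp.eventually (hU.piece_eventuallyEq k)] with t hmono hval hpiece
  by_cases h : ∃ i, X i t = 0
  · obtain ⟨i, hi⟩ := h
    have hle : ∀ j, j ≤ i → X j t ≤ 0 := fun j hj => hi ▸ hmono.monotone hj
    have hge : ∀ j, i ≤ j → 0 ≤ X j t := fun j hj => hi ▸ hmono.monotone hj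
    have hv := hval i
    rw [hi] at hv
    rcases hv with hv | hv
    · exact ⟨i.castSucc, ⟨fun j hj => hle j (Fin.castSucc_lt_castSucc_iff.1 hj).le,
        fun j hj => hge j (Fin.castSucc_le_castSucc_iff.1 hj)⟩, hv, fun hne => absurd hi (hne i)⟩
    · refine ⟨i.succ, ⟨fun j hj => hle j (Fin.castSucc_lt_succ_iff.1 hj), fun j hj => hge j ?_⟩,
        hv, fun hne => absurd hi (hne i)⟩
      exact Fin.castSucc_le_castSucc_iff.1 (Fin.castSucc_lt_succ.le.trans hj)
  · push Not at h
    obtain ⟨k, hk⟩ := exists_inSector (q := (0, t)) hmono fun i => (h i).symm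
    refine ⟨k, hk.axisTouches, (hpiece k hk).eq_of_nhds, fun _ => ?_⟩
    exact ((by fun_prop : Continuous fun τ : ℝ => ((0:ℝ), τ)).tendsto t).eventually (hpiece k hk)

/-- Curves tangent to the axis may cross it infinitely often, so no single sector need contain it
for small `t`. It suffices that all sectors meeting it at arbitrarily small times share the
derivative `d`, as there are finitely many. -/
theorem IsAcousticSolution.hasLimitTimeDeriv
    (hU : IsAcousticSolution γ a Cv UL UR UL' UR' Us U X W) {q : (Fin 3 → ℝ) → ℝ}
    (hq : ContDiffAt ℝ 1 q Us) {d : ℝ}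
    (hd : ∀ k, SpeedsStraddle X k → fderiv ℝ q Us (fderiv ℝ (W k) (0, 0) (0, 1)) = d) :
    HasLimitTimeDeriv U X Us q d := by
  set g : Fin (n + 1) → ℝ → ℝ := fun k t => q (W k (0, t)) with hg
  have hgc : ∀ k, ContDiffAt ℝ 1 (g k) 0 := fun k => by
    have h1 : ContDiffAt ℝ 1 (fun t : ℝ => W k (0, t)) 0 :=
      ContDiffAt.comp (g := W k) (f := fun t : ℝ => ((0:ℝ), t)) 0 (hU.piece_smooth k) (by fun_prop)
    refine ContDiffAt.comp (g := q) 0 ?_ h1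
    rwa [hU.piece_origin k]
  have hg0 : ∀ k, HasDerivAt (g k) (fderiv ℝ q Us (fderiv ℝ (W k) (0, 0) (0, 1))) 0 := fun k => by
    have h1 : HasDerivAt (fun t : ℝ => W k (0, t)) (fderiv ℝ (W k) (0, 0) (0, 1)) 0 :=
      ((hU.piece_smooth k).differentiableAt one_ne_zero).hasFDerivAt.comp_hasDerivAt_of_eq (0:ℝ)
        ((hasDerivAt_const _ _).prodMk (hasDerivAt_id _)) rfl
    exact (hq.differentiableAt one_ne_zero).hasFDerivAt.comp_hasDerivAt_of_eq (0:ℝ) h1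
      (hU.piece_origin k).symm
  -- Each sector either stays away from the axis for all small times or has the right derivative at
  -- `0`.
  have hcases : ∀ k, (∀ᶠ t in 𝓝[>] (0 : ℝ), ¬ AxisTouches X k t) ∨ HasDerivAt (g k) d 0 := by
    intro k
    by_cases h : ∃ᶠ t in 𝓝[>] (0 : ℝ), AxisTouches X k t
    · exact Or.inr (hd k (hU.speedsStraddle_of_frequently h) ▸ hg0 k)
    · exact Or.inl (not_frequently.1 h)
  have hle : 𝓝[{t : ℝ | 0 < t ∧ ∀ i, X i t ≠ 0}] 0 ≤ 𝓝[>] 0 :=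
    nhdsWithin_mono 0 fun t ht => ht.1
  have hloc : ∀ᶠ t in 𝓝[{t : ℝ | 0 < t ∧ ∀ i, X i t ≠ 0}] 0, ∃ k, AxisTouches X k t ∧
      (fun τ => q (U (0, τ))) =ᶠ[𝓝 t] g k := by
    filter_upwards [hU.eventually_exists_axis_eq.filter_mono hle, self_mem_nhdsWithin]
      with t ⟨k, hk, _, hk'⟩ ht
    exact ⟨k, hk, (hk' ht.2).fun_comp q⟩
  refine ⟨?_, ?_, ?_⟩
  · have hdiff : ∀ᶠ t in 𝓝 (0 : ℝ), ∀ k, DifferentiableAt ℝ (g k) t := eventually_all.2 fun k =>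
      ((hgc k).eventually (by simp)).mono fun _ h => h.differentiableAt one_ne_zero
    filter_upwards [hloc, hdiff.filter_mono nhdsWithin_le_nhds] with t ⟨k, _, hk⟩ ht
    exact hk.differentiableAt_iff.2 (ht k)
  · refine tendsto_def.2 fun s hs => ?_
    have hk : ∀ k, ∀ᶠ t in 𝓝[>] (0 : ℝ), AxisTouches X k t → deriv (g k) t ∈ s := fun k => by
      rcases hcases k with h | h
      · exact h.mono fun _ h h' => absurd h' h
      · have hc : Tendsto (deriv (g k)) (𝓝 0) (𝓝 d) := by
          have := ((hgc k).fderiv_right (m := 0) (by simp)).continuousAt.clm_apply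
            (continuousAt_const (y := (1:ℝ)))
          rw [← h.deriv]
          exact this.tendsto
        exact ((hc.mono_left nhdsWithin_le_nhds).eventually hs).mono fun _ h _ => h
    filter_upwards [hloc, (eventually_all.2 hk).filter_mono hle] with t ⟨k, hk1, hk2⟩ ht
    rw [mem_preimage, hk2.deriv_eq]
    exact ht k hk1
  · refine tendsto_def.2 fun s hs => ?_
    have hk : ∀ k, ∀ᶠ t in 𝓝[>] (0 : ℝ), AxisTouches X k t → (g k t - q Us) / t ∈ s := fun k => by
      rcases hcases k with h | h
      · exact h.mono fun _ h h' => absurd h' h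
      · have := (hasDerivAt_iff_tendsto_slope_zero.1 h).mono_left
          (nhdsWithin_mono (0:ℝ) (fun x hx => ne_of_gt hx : Ioi (0:ℝ) ⊆ {0}ᶜ))
        refine (this.eventually_mem hs).mono fun t ht _ => ?_
        simpa [hg, hU.piece_origin k, div_eq_inv_mul] using ht
    filter_upwards [hU.eventually_exists_axis_eq, eventually_all.2 hk] with t ⟨k, hk1, hk2, _⟩ ht
    rw [mem_preimage, hk2]
    exact ht k hk1

/-- Along a left eigenvector with positive speed, the time derivative is determined by the data on
the left. -/
theorem IsAcousticSolution.left_eigenvector_time_deriv_of_pos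
    (hU : IsAcousticSolution γ a Cv UL UR UL' UR' Us U X W)
    (hf : ContDiffAt ℝ 1 (flux γ a Cv) Us) {ℓ : (Fin 3 → ℝ) →L[ℝ] ℝ} {lam : ℝ}
    (hℓ : ∀ w, ℓ (fderiv ℝ (flux γ a Cv) Us w) = lam * ℓ w) (hlam : 0 < lam) {k : Fin (n + 1)}
    (hk : SpeedsStraddle X k) : ℓ (fderiv ℝ (W k) (0, 0) (0, 1)) = -(lam * ℓ UL') := by
  rw [eq_neg_of_add_eq_zero_left (hU.piece_law hf k), map_neg, hℓ, ← hU.first_piece.2]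
  congr 2
  -- Curves to the left of sector `k` have speed `≤ 0 < lam`, so none is characteristic for `ℓ`.
  exact eq_zero_apply_of_forall_succ (g := fun k => ℓ (fderiv ℝ (W k) (0, 0) (1, 0)))
    fun i hi => hU.left_eigenvector_slope_eq hf hℓ ((hk.1 i hi).trans_lt hlam).ne

/-- Along a left eigenvector with negative speed, the time derivative is determined by the data on
the right. -/
theorem IsAcousticSolution.left_eigenvector_time_deriv_of_neg
    (hU : IsAcousticSolution γ a Cv UL UR UL' UR' Us U X W)
    (hf : ContDiffAt ℝ 1 (flux γ a Cv) Us) {ℓ : (Fin 3 → ℝ) →L[ℝ] ℝ} {lam : ℝ}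
    (hℓ : ∀ w, ℓ (fderiv ℝ (flux γ a Cv) Us w) = lam * ℓ w) (hlam : lam < 0) {k : Fin (n + 1)}
    (hk : SpeedsStraddle X k) : ℓ (fderiv ℝ (W k) (0, 0) (0, 1)) = -(lam * ℓ UR') := by
  rw [eq_neg_of_add_eq_zero_left (hU.piece_law hf k), map_neg, hℓ, ← hU.last_piece.2]
  congr 2
  exact eq_last_apply_of_forall_succ (g := fun k => ℓ (fderiv ℝ (W k) (0, 0) (1, 0)))
    fun i hi => hU.left_eigenvector_slope_eq hf hℓ (hlam.trans_le (hk.2 i hi)).ne'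

end Acoustic

end RHE

/-! ### Assembly from the three characteristic relations. -/

theorem mainTheorem9 (γ a Cv : ℝ) (hγ : 1 < γ) (ha : 0 ≤ a) (hCv : 0 < Cv)
    (UL UR UL' UR' Us : Fin 3 → ℝ) (hadm : RHE.Admissible UL)
    (hLR : UL = UR) (hne : UL' ≠ UR')
    (U : ℝ × ℝ → Fin 3 → ℝ) (n : ℕ) (X : Fin n → ℝ → ℝ) (W : Fin (n + 1) → ℝ × ℝ → Fin 3 → ℝ)
    (hU : RHE.IsAcousticSolution γ a Cv UL UR UL' UR' Us U X W)
    (ρs us cs uL' pL' SL' uR' pR' SR' Pt : ℝ)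
    (hρs : ρs = RHE.density Us) (hus : us = RHE.velocity Us) (hcs : cs = RHE.soundOf γ a Cv Us)
    (huL' : uL' = RHE.dataSlope RHE.velocity UL UL')
    (hpL' : pL' = RHE.dataSlope (RHE.pressureOf γ a Cv) UL UL')
    (hSL' : SL' = RHE.dataSlope (RHE.entropyOf γ a Cv) UL UL')
    (huR' : uR' = RHE.dataSlope RHE.velocity UR UR')
    (hpR' : pR' = RHE.dataSlope (RHE.pressureOf γ a Cv) UR UR')
    (hSR' : SR' = RHE.dataSlope (RHE.entropyOf γ a Cv) UR UR')
    (hPt : Pt = -(ρs * cs / 2) *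
      ((us + cs) * (uL' + pL' / (ρs * cs)) - (us - cs) * (uR' - pR' / (ρs * cs))))
    (h1 : us - cs < 0) (h3 : 0 < us + cs) :
    RHE.HasLimitTimeDeriv U X Us RHE.velocity
      (-(1 / 2) *
        ((us + cs) * (uL' + pL' / (ρs * cs)) + (us - cs) * (uR' - pR' / (ρs * cs)))) ∧
    RHE.HasLimitTimeDeriv U X Us (RHE.pressureOf γ a Cv) Pt ∧
    (0 < us → RHE.HasLimitTimeDeriv U X Us RHE.density
      (1 / cs ^ 2 * (Pt + us * RHE.dpdSOf γ a Cv Us * SL'))) ∧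
    (us < 0 → RHE.HasLimitTimeDeriv U X Us RHE.density
      (1 / cs ^ 2 * (Pt + us * RHE.dpdSOf γ a Cv Us * SR'))) := by
  have hUs : UL = Us := hU.first_piece.1.symm.trans (hU.piece_origin 0)
  subst hUs
  subst hLR
  have hf := RHE.contDiffAt_flux (γ := γ) ha hCv hadm
  have hv := RHE.contDiffAt_velocity hadm
  have hp := RHE.contDiffAt_pressureOf (γ := γ) ha hCv hadm
  have hS := RHE.contDiffAt_entropyOf hγ ha hCv hadm
  have hρ0 : 0 < ρs := hρs ▸ hadm.1
  have hc0 : 0 < cs := hcs ▸ RHE.soundOf_pos hγ ha hCv hadm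
  rw [RHE.dataSlope_eq_fderiv hv] at huL' huR'
  rw [RHE.dataSlope_eq_fderiv hp] at hpL' hpR'
  rw [RHE.dataSlope_eq_fderiv hS] at hSL' hSR'
  have hAv : ∀ w, ρs * fderiv ℝ RHE.velocity UL (fderiv ℝ (RHE.flux γ a Cv) UL w) =
      ρs * us * fderiv ℝ RHE.velocity UL w + fderiv ℝ (RHE.pressureOf γ a Cv) UL w := by
    rw [hρs, hus]
    exact RHE.fderiv_velocity_fderiv_flux ha hCv hadm
  have hAp : ∀ w, fderiv ℝ (RHE.pressureOf γ a Cv) UL (fderiv ℝ (RHE.flux γ a Cv) UL w) =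
      us * fderiv ℝ (RHE.pressureOf γ a Cv) UL w + ρs * cs ^ 2 * fderiv ℝ RHE.velocity UL w := by
    rw [hρs, hus, hcs]
    exact RHE.fderiv_pressureOf_fderiv_flux hγ ha hCv hadm
  have hAS : ∀ w, fderiv ℝ (RHE.entropyOf γ a Cv) UL (fderiv ℝ (RHE.flux γ a Cv) UL w) =
      us * fderiv ℝ (RHE.entropyOf γ a Cv) UL w := by
    rw [hus]
    exact RHE.fderiv_entropyOf_fderiv_flux hγ ha hCv hadm
  -- `dp + ρ c du` is a left eigenform with eigenvalue `u + c > 0`, so it is governed by the left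
  -- data.
  have hplus : ∀ k, RHE.SpeedsStraddle X k →
      fderiv ℝ (RHE.pressureOf γ a Cv) UL (fderiv ℝ (W k) (0, 0) (0, 1)) +
        ρs * cs * fderiv ℝ RHE.velocity UL (fderiv ℝ (W k) (0, 0) (0, 1)) =
      -((us + cs) * (pL' + ρs * cs * uL')) := fun k hk => by
    rw [hpL', huL']
    refine hU.left_eigenvector_time_deriv_of_pos hf
      (ℓ := fderiv ℝ (RHE.pressureOf γ a Cv) UL + (ρs * cs) • fderiv ℝ RHE.velocity UL) (fun w => ?_) h3 hk
    simp only [add_apply, smul_apply, smul_eq_mul]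
    linear_combination hAp w + cs * hAv w
  have hminus : ∀ k, RHE.SpeedsStraddle X k →
      fderiv ℝ (RHE.pressureOf γ a Cv) UL (fderiv ℝ (W k) (0, 0) (0, 1)) -
        ρs * cs * fderiv ℝ RHE.velocity UL (fderiv ℝ (W k) (0, 0) (0, 1)) =
      -((us - cs) * (pR' - ρs * cs * uR')) := fun k hk => by
    rw [hpR', huR']
    refine hU.left_eigenvector_time_deriv_of_neg hf
      (ℓ := fderiv ℝ (RHE.pressureOf γ a Cv) UL - (ρs * cs) • fderiv ℝ RHE.velocity UL) (fun w => ?_) h1 hk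
    simp only [sub_apply, smul_apply, smul_eq_mul]
    linear_combination hAp w - cs * hAv w
  have hpt : ∀ k, RHE.SpeedsStraddle X k →
      fderiv ℝ (RHE.pressureOf γ a Cv) UL (fderiv ℝ (W k) (0, 0) (0, 1)) = Pt := fun k hk => by
    have h : Pt = -((us + cs) * (pL' + ρs * cs * uL') + (us - cs) * (pR' - ρs * cs * uR')) / 2 := by
      rw [hPt]
      field_simp
      ring
    rw [h]
    linear_combination (hplus k hk + hminus k hk) / 2
  -- `dp = c² dρ + (∂p/∂S) dS` solved for `dρ`, with the entropy rate `-u S'` left open until the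
  -- sign of `u` selects the side.
  have hρt : ∀ k, RHE.SpeedsStraddle X k → ∀ {S' : ℝ},
      fderiv ℝ (RHE.entropyOf γ a Cv) UL (fderiv ℝ (W k) (0, 0) (0, 1)) = -(us * S') →
      fderiv ℝ RHE.density UL (fderiv ℝ (W k) (0, 0) (0, 1)) =
        1 / cs ^ 2 * (Pt + us * RHE.dpdSOf γ a Cv UL * S') := fun k hk S' hSt => by
    have h := RHE.fderiv_pressureOf_eq hγ ha hCv hadm (fderiv ℝ (W k) (0, 0) (0, 1))
    rw [hpt k hk, hSt, ← hcs] at h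
    rw [h]
    field_simp
    ring
  refine ⟨hU.hasLimitTimeDeriv hv fun k hk => ?_, hU.hasLimitTimeDeriv hp hpt,
    fun hu => hU.hasLimitTimeDeriv (RHE.contDiffAt_density _) fun k hk => hρt k hk ?_,
    fun hu => hU.hasLimitTimeDeriv (RHE.contDiffAt_density _) fun k hk => hρt k hk ?_⟩
  · have hne : 2 * (ρs * cs) ≠ 0 := by positivity
    refine mul_left_cancel₀ hne ?_
    have h : 2 * (ρs * cs) * (-(1 / 2) * ((us + cs) * (uL' + pL' / (ρs * cs)) +
        (us - cs) * (uR' - pR' / (ρs * cs)))) =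
        -((us + cs) * (pL' + ρs * cs * uL') - (us - cs) * (pR' - ρs * cs * uR')) := by
      field_simp
      ring
    rw [h]
    linear_combination hplus k hk - hminus k hk
  · rw [hSL']
    exact hU.left_eigenvector_time_deriv_of_pos hf hAS hu hk
  · rw [hSR']
    exact hU.left_eigenvector_time_deriv_of_neg hf hAS hu hk
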